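/- Let $X$ be a real Banach space that contains no (isomorphic) copy of $\ell_1$ and has a normalized Schauder basis $(e_k)_{k=1}^\infty$, with biorthogonal functionals $(e_k^*)_{k=1}^\infty\subset X^*$. Call a basic sequence $(u_k)_{k=1}^\infty$ skipped $\lambda$-unconditional if, whenever $0=m_0<m_1<\dots<m_n<\infty$ with $m_j-m_{j-1}\ge 2$ for $1\le j\le n$ and $y_j\in \operatorname{span}\{u_i: m_{j-1}+1\le i\le m_j-1\}$, one has $\|\sum_{j=1}^n\epsilon_j y_j\|\le\lambda\|\sum_{j=1}^n y_j\|$ for all signs $\epsilon_j=\pm1$. Suppose that $(e_k)$ is asymptotically skipped $1$-unconditional: for every $\lambda>1$ there is $n\ge 1$ such that for every nonzero $x\in\operatorname{span}\{e_1,\dots,e_n\}$ the basic sequence $(x,e_{n+1},e_{n+2},\dots)$ is skipped $\lambda$-unconditional. Suppose also that $X$ fails property $(au^*)$, where $X$ has $(au^*)$ if $\lim_{n\to\infty}(\|x^*+x_n^*\|-\|x^*-x_n^*\|)=0$ whenever $x^*\in X^*$ and $(x_n^*)$ is a weak$^*$-null sequence in $X^*$. Then: (i) No subsequence of $(e_k^*)_{k=1}^\infty$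 is an unconditional basic sequence. (ii) Every spreading model of $(e_k)_{k=1}^\infty$ is equivalent to the unit vector basis of $\ell_1$. Here a spreading model of $(e_k)$ is a sequence $(f_j)$ in a Banach space for which there is a subsequence $(e_{k_i})_{i=1}^\infty$ such that for all $r$ and all $a_1,\dots,a_r\in\mathbb R$ the norms $\|\sum_{j=1}^r a_j e_{k_{i_j}}\|$, with $i_1<\dots<i_r$, converge to $\|\sum_{j=1}^r a_jf_j\|$ as $i_1\to\infty$. -/

import Mathlib

open Filter Topology

/-- `X` contains a copy of `ℓ₁`: some bounded linear map `ℓ₁ → X` is bounded below, i.e. is an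
isomorphism onto a closed subspace of `X`. -/
def ContainsCopyOfEllOne (X : Type*) [NormedAddCommGroup X] [NormedSpace ℝ X] : Prop :=
  ∃ (T : lp (fun _ : ℕ => ℝ) 1 →L[ℝ] X) (c : ℝ),
    0 < c ∧ ∀ a : lp (fun _ : ℕ => ℝ) 1, c * ‖a‖ ≤ ‖T a‖

/-- Property `(au*)`: `‖x* + xₙ*‖ - ‖x* - xₙ*‖ → 0` whenever `x* ∈ X*` and `(xₙ*)` is a
weak*-null sequence in `X*`. (This is meant for separable `X`; a space with a Schauder basis is
separable.) -/
def PropertyAUStar (X : Type*) [NormedAddCommGroup X] [NormedSpace ℝ X] : Prop :=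
  ∀ (f : StrongDual ℝ X) (g : ℕ → StrongDual ℝ X),
    Tendsto (fun n => StrongDual.toWeakDual (g n)) atTop (𝓝 0) →
      Tendsto (fun n => ‖f + g n‖ - ‖f - g n‖) atTop (𝓝 0)

/-- The sequence `(u₀, u₁, …)` is skipped `C`-unconditional. In one-based indexing: whenever
`0 = m₀ < m₁ < ⋯ < mₙ` with `mⱼ - mⱼ₋₁ ≥ 2` and `yⱼ` is in the span of the vectors with index
from `mⱼ₋₁ + 1` to `mⱼ - 1`, then `‖∑ εⱼ yⱼ‖ ≤ C ‖∑ yⱼ‖` for all signs `εⱼ`.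
In the zero-based indexing used here that block consists of the `u i` with
`mⱼ₋₁ ≤ i` and `i + 1 < mⱼ`. -/
def IsSkippedUnconditional {X : Type*} [NormedAddCommGroup X] [NormedSpace ℝ X]
    (C : ℝ) (u : ℕ → X) : Prop :=
  ∀ (n : ℕ) (m : ℕ → ℕ), m 0 = 0 → (∀ j < n, m j + 2 ≤ m (j + 1)) →
    ∀ y : ℕ → X,
      (∀ j < n, y j ∈ Submodule.span ℝ (u '' {i : ℕ | m j ≤ i ∧ i + 1 < m (j + 1)})) →
      ∀ ε : ℕ → ℝ, (∀ j, ε j = 1 ∨ ε j = -1) →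
        ‖∑ j ∈ Finset.range n, ε j • y j‖ ≤ C * ‖∑ j ∈ Finset.range n, y j‖

/-- The sequence `x, u 0, u 1, u 2, …`. -/
def prependSeq {X : Type*} (x : X) (u : ℕ → X) : ℕ → X
  | 0 => x
  | k + 1 => u k

/-- `(e₀, e₁, …)` is asymptotically skipped `1`-unconditional: for every `C > 1` there is `n ≥ 1`
such that for each nonzero `x` in the span of the first `n` vectors, the sequence consisting of
`x` followed by all vectors of `e` after the first `n` is skipped `C`-unconditional. -/
def IsAsymptoticallySkippedOneUnconditional {X : Type*} [NormedAddCommGroup X] [NormedSpace ℝ X]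
    (e : ℕ → X) : Prop :=
  ∀ C : ℝ, 1 < C → ∃ n : ℕ, 1 ≤ n ∧
    ∀ x ∈ Submodule.span ℝ (e '' {k : ℕ | k < n}), x ≠ 0 →
      IsSkippedUnconditional C (prependSeq x (fun k => e (n + k)))

/-- `(xₙ)` is an unconditional (basic) sequence: its terms are nonzero and its unconditional basis
constant is finite. -/
def IsUnconditionalSeq {X : Type*} [NormedAddCommGroup X] [NormedSpace ℝ X]
    (x : ℕ → X) : Prop :=
  (∀ n, x n ≠ 0) ∧ ∃ C : ℝ, ∀ (s : Finset ℕ) (a ε : ℕ → ℝ), (∀ j, ε j = 1 ∨ ε j = -1) →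
    ‖∑ j ∈ s, (ε j * a j) • x j‖ ≤ C * ‖∑ j ∈ s, a j • x j‖

/-- `(fⱼ)` is a spreading model of `(eₙ)`: for some subsequence `(e_{φ(n)})`, and all scalars
`a₁, …, a_k`, the norms `‖a₁ e_{φ(n₁)} + ⋯ + a_k e_{φ(n_k)}‖` with `n₁ < ⋯ < n_k` converge to
`‖a₁ f₁ + ⋯ + a_k f_k‖` as `n₁ → ∞`. -/
def IsSpreadingModel {X E : Type*} [NormedAddCommGroup X] [NormedSpace ℝ X]
    [NormedAddCommGroup E] [NormedSpace ℝ E] (f : ℕ → E) (e : ℕ → X) : Prop :=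
  ∃ φ : ℕ → ℕ, StrictMono φ ∧
    ∀ (k : ℕ) (a : Fin k → ℝ) (δ : ℝ), 0 < δ →
      ∃ N : ℕ, ∀ n : Fin k → ℕ, StrictMono n → (∀ i, N ≤ n i) →
        |‖∑ i, a i • e (φ (n i))‖ - ‖∑ i, a i • f i‖| < δ

/-- Equivalence of two sequences (in possibly different normed spaces): the norms of finite linear
combinations with the same coefficients are comparable, with uniform constants. -/
def AreEquivalentSeq {E F : Type*} [NormedAddCommGroup E] [NormedSpace ℝ E]
    [NormedAddCommGroup F] [NormedSpace ℝ F] (x : ℕ → E) (y : ℕ → F) : Prop :=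
  ∃ c C : ℝ, 0 < c ∧ 0 < C ∧ ∀ (s : Finset ℕ) (a : ℕ → ℝ),
    c * ‖∑ j ∈ s, a j • y j‖ ≤ ‖∑ j ∈ s, a j • x j‖ ∧
      ‖∑ j ∈ s, a j • x j‖ ≤ C * ‖∑ j ∈ s, a j • y j‖

/-- The unit vector basis of `ℓ₁`. -/
noncomputable def ellOneBasis (n : ℕ) : lp (fun _ : ℕ => ℝ) 1 :=
  lp.single 1 n (1 : ℝ)

/-!
Write `e` for the basis. The argument splits into a criterion for `(au*)` and two ways of verifying
it.

*Criterion.* The basis has asymptotic reflections (`HasAsymptoticReflections`) if every finite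
vector `x` of norm at most one can be changed inside a window of coordinates `[L, M)` that does not
depend on `x`, with its part beyond the window replaced by its negative, at the cost of an
arbitrarily small increase of the norm. Since `X` contains no `ℓ₁`, the basis is shrinking:
otherwise some functional is bounded below on a normalized skipped block sequence, which is
unconditional, hence an `ℓ₁`-basis (`exists_forall_abs_le_of_not_containsCopyOfEllOne`). So a given
functional `f` essentially lives before the window and the terms of a weak*-null sequence `g`
eventually live beyond it. Reflecting vectors that almost norm `f + g n` yields
`‖f + g n‖ ≤ ‖f - g n‖ + o(1)`, and `(au*)` follows (`HasAsymptoticReflections.propertyAUStar`).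

*Building reflections.* If a coordinate of `z` vanishes, skipped unconditionality allows the part of
`z` beyond it to be negated. Suppose that `z` agrees with `x` outside the window, vanishes at the
odd members of a list of `2 ^ (m + 1) - 1` indices and agrees with `x` at the even ones. Flip the
parts of `z` between the first and second odd index, between the third and fourth, and so on, and
average with `x`. The result again agrees with `x` outside the window, vanishes at every other even
index of the list and agrees with `x` at the remaining ones, so the number of gaps is halved; and so
is the excess of the norm over `‖x‖`, up to factors as close to one as desired. After `m` rounds,
one gap remains, and the excess has become `2⁻ᵐ ‖x - z‖` (`exists_reflection_of_sign_changes`).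
Hence reflections exist as soon as the coordinates of `x` at `2 ^ m` places can be removed by
subtracting a vector of norm `o(2 ^ m)`.

*The two cases.* If a spreading model is not equivalent to the basis of `ℓ₁`, then averaging over
shifts gives `‖f 0 + ⋯ + f (N - 1)‖ = o(N)`, and by unconditionality it is enough to subtract the
coordinates themselves (`hasAsymptoticReflections_of_small_sums`). If `(e*_{φ k})` is unconditional,
either some coordinate of `x` in the window is small, and removing it is cheap, or all of them are
bounded below. Then the functionals satisfy a lower `ℓ₁`-estimate, and Helly's theorem provides a
vector of norm bounded independently of `m` with the prescribed coordinates
(`hasAsymptoticReflections_of_isUnconditionalSeq_coord`).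
-/

/-! ### Sign changes and skipped unconditionality -/

/-- A bound for all choices of signs extends to all coefficients in `[-1, 1]`, because the norm is a
convex function of each coefficient. The vector `x` makes the induction on `s` work. -/
theorem norm_add_sum_smul_le_of_signs {X : Type*} [NormedAddCommGroup X] [NormedSpace ℝ X]
    {B : ℝ} (v : ℕ → X) (s : Finset ℕ) (x : X)
    (h : ∀ ε : ℕ → ℝ, (∀ j, ε j = 1 ∨ ε j = -1) → ‖x + ∑ j ∈ s, ε j • v j‖ ≤ B)
    (a : ℕ → ℝ) (ha : ∀ j ∈ s, |a j| ≤ 1) : ‖x + ∑ j ∈ s, a j • v j‖ ≤ B := by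
  induction s using Finset.induction_on generalizing x with
  | empty => simpa using h 1 (fun _ => Or.inl rfl)
  | insert k s hk ih =>
    have key : ∀ t : ℝ, t = 1 ∨ t = -1 → ‖(x + t • v k) + ∑ j ∈ s, a j • v j‖ ≤ B := by
      intro t ht
      refine ih _ (fun ε hε => ?_) fun j hj => ha j (Finset.mem_insert_of_mem hj)
      have := h (Function.update ε k t) (fun j => by
        by_cases hjk : j = k
        · subst hjk; simpa using ht
        · simpa [hjk] using hε j)
      rw [Finset.sum_insert hk] at this
      rw [add_assoc]
      convert this using 4
      · simp
      · refine Finset.sum_congr rfl fun j hj => ?_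
        have : j ≠ k := fun hjk => hk (hjk ▸ hj)
        simp [this]
    have hak := abs_le.1 (ha k (Finset.mem_insert_self k s))
    set y := ∑ j ∈ s, a j • v j
    rw [Finset.sum_insert hk]
    have heq : x + (a k • v k + y)
        = ((1 + a k) / 2) • ((x + (1 : ℝ) • v k) + y)
          + ((1 - a k) / 2) • ((x + (-1 : ℝ) • v k) + y) := by module
    rw [heq]
    calc _ ≤ (1 + a k) / 2 * B + (1 - a k) / 2 * B := by
          refine (norm_add_le _ _).trans ?_
          rw [norm_smul, norm_smul, Real.norm_of_nonneg (by linarith),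
            Real.norm_of_nonneg (by linarith)]
          gcongr
          · linarith
          · exact key 1 (Or.inl rfl)
          · linarith
          · exact key (-1) (Or.inr rfl)
      _ = B := by ring

/-- Skipped unconditionality in terms of coefficients: a sign pattern may change its value at any
index whose coefficient is zero. -/
theorem IsSkippedUnconditional.norm_sum_sign_smul_le {X : Type*} [NormedAddCommGroup X]
    [NormedSpace ℝ X] {C : ℝ} {u : ℕ → X} (hu : IsSkippedUnconditional C u)
    (R : ℕ) (c σ : ℕ → ℝ) (hσ : ∀ i, σ i = 1 ∨ σ i = -1)
    (hchange : ∀ i, σ (i + 1) ≠ σ i → c (i + 1) = 0) :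
    ‖∑ i ∈ Finset.range R, (σ i * c i) • u i‖ ≤ C * ‖∑ i ∈ Finset.range R, c i • u i‖ := by
  classical
  set c' : ℕ → ℝ := fun i => if i < R then c i else 0 with hc'
  have hex : ∀ k, ∃ g, k + 1 ≤ g ∧ c' g = 0 := fun k =>
    ⟨k + 1 + R, by omega, by simp [hc']⟩
  -- `nz k` is the first zero after `k`; the blocks end just before such zeros
  set nz : ℕ → ℕ := fun k => Nat.find (hex k) with hnz
  have hnz1 : ∀ k, k + 1 ≤ nz k := fun k => (Nat.find_spec (hex k)).1
  have hnz2 : ∀ k, c' (nz k) = 0 := fun k => (Nat.find_spec (hex k)).2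
  have hnz3 : ∀ k i, k + 1 ≤ i → i < nz k → c' i ≠ 0 := fun k i h1 h2 h3 =>
    Nat.find_min (hex k) h2 ⟨h1, h3⟩
  set m : ℕ → ℕ := fun j => Nat.rec 0 (fun _ k => nz k + 1) j with hm
  have hm0 : m 0 = 0 := rfl
  have hms : ∀ j, m (j + 1) = nz (m j) + 1 := fun j => rfl
  have hmR : ∀ j, j ≤ m j := by
    intro j
    induction j with
    | zero => simp
    | succ j ih => rw [hms]; have := hnz1 (m j); omega
  have hconst : ∀ j i, m j ≤ i → i < nz (m j) → σ i = σ (m j) := by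
    intro j i h1
    induction i, h1 using Nat.le_induction with
    | base => intro _; rfl
    | succ i hi ih =>
      intro h2
      rw [← ih (by omega)]
      by_contra hne
      have h0 := hchange i hne
      exact hnz3 (m j) (i + 1) (by omega) h2 (by simp [hc', h0])
  have hsum : ∀ (τ : ℕ → ℝ) (n : ℕ), ∑ j ∈ Finset.range n, ∑ i ∈ Finset.Ico (m j) (m (j + 1)),
      (τ i * c' i) • u i = ∑ i ∈ Finset.range (m n), (τ i * c' i) • u i := by
    intro τ n
    induction n with
    | zero => simp [hm0]
    | succ n ih =>
      rw [Finset.sum_range_succ, ih, Finset.range_eq_Ico, Finset.range_eq_Ico,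
        Finset.sum_Ico_consecutive _ (Nat.zero_le _)]
      rw [hms]; have := hnz1 (m n); omega
  have htrunc : ∀ τ : ℕ → ℝ, ∑ i ∈ Finset.range (m R), (τ i * c' i) • u i
      = ∑ i ∈ Finset.range R, (τ i * c i) • u i := by
    intro τ
    symm
    refine (Finset.sum_congr rfl fun i hi => ?_).trans
      (Finset.sum_subset (Finset.range_mono (hmR R)) fun i _ hi => ?_)
    · simp [hc', Finset.mem_range.1 hi]
    · simp only [Finset.mem_range] at hi; simp [hc', hi]
  set y : ℕ → X := fun j => ∑ i ∈ Finset.Ico (m j) (m (j + 1)), ((1 : ℝ) * c' i) • u i with hy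
  have := hu R m hm0 (fun j _ => by rw [hms]; have := hnz1 (m j); omega) y (fun j _ => ?_)
    (fun j => σ (m j)) (fun j => hσ _)
  · rw [hsum (fun _ => 1) R, htrunc] at this
    simp only [one_mul] at this
    convert this using 2
    rw [← htrunc, ← hsum]
    refine Finset.sum_congr rfl fun j _ => ?_
    rw [hy, Finset.smul_sum]
    refine Finset.sum_congr rfl fun i hi => ?_
    rw [Finset.mem_Ico, hms] at hi
    rcases Nat.lt_or_ge i (nz (m j)) with h | h
    · rw [hconst j i hi.1 h, one_mul, smul_smul]
    · have : i = nz (m j) := by omega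
      rw [this, hnz2]; simp
  · refine Submodule.sum_mem _ fun i hi => ?_
    rw [Finset.mem_Ico] at hi
    rcases Nat.lt_or_ge (i + 1) (m (j + 1)) with h | h
    · exact Submodule.smul_mem _ _ (Submodule.subset_span ⟨i, ⟨hi.1, h⟩, rfl⟩)
    · have : i = nz (m j) := by have := hms j; omega
      rw [this, hnz2]; simp

/-- The flipping inequality for the sequence `e` itself, when the signs are `1` on the first `n`
vectors, which are lumped into the vector prepended to the tail of `e`. -/
theorem norm_sum_sign_smul_le_of_prepend {X : Type*} [NormedAddCommGroup X]
    [NormedSpace ℝ X] {C : ℝ} {e : ℕ → X} {n : ℕ} (hn : 1 ≤ n) (he : e 0 ≠ 0)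
    (h : ∀ x ∈ Submodule.span ℝ (e '' {k : ℕ | k < n}), x ≠ 0 →
      IsSkippedUnconditional C (prependSeq x (fun k => e (n + k))))
    (R : ℕ) (hR : n ≤ R) (c σ : ℕ → ℝ) (hσ : ∀ i, σ i = 1 ∨ σ i = -1) (hσn : ∀ i < n, σ i = 1)
    (hchange : ∀ i, σ (i + 1) ≠ σ i → c (i + 1) = 0) :
    ‖∑ i ∈ Finset.range R, (σ i * c i) • e i‖ ≤ C * ‖∑ i ∈ Finset.range R, c i • e i‖ := by
  classical
  obtain ⟨r, rfl⟩ := Nat.exists_eq_add_of_le hR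
  set x := ∑ i ∈ Finset.range n, c i • e i with hx
  have hxmem : x ∈ Submodule.span ℝ (e '' {k : ℕ | k < n}) :=
    Submodule.sum_mem _ fun i hi => Submodule.smul_mem _ _
      (Submodule.subset_span ⟨i, Finset.mem_range.1 hi, rfl⟩)
  -- if the head vanishes, `e 0` with coefficient `0` plays its role
  obtain ⟨x', t, hx'mem, hx'0, htx⟩ : ∃ (x' : X) (t : ℝ),
      x' ∈ Submodule.span ℝ (e '' {k : ℕ | k < n}) ∧ x' ≠ 0 ∧ t • x' = x := by
    by_cases h0 : x = 0
    · exact ⟨e 0, 0, Submodule.subset_span ⟨0, by simp; omega, rfl⟩, he, by simp [h0]⟩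
    · exact ⟨x, 1, hxmem, h0, one_smul _ _⟩
  have key := (h x' hx'mem hx'0).norm_sum_sign_smul_le (r + 1)
    (fun k => Nat.casesOn k t fun k => c (n + k)) (fun k => Nat.casesOn k 1 fun k => σ (n + k))
    (fun k => by cases k <;> simp [hσ]) (fun k => ?_)
  · have hhead : ∑ i ∈ Finset.range n, (σ i * c i) • e i = x := by
      rw [hx]
      refine Finset.sum_congr rfl fun i hi => ?_
      rw [hσn i (Finset.mem_range.1 hi), one_mul]
    rw [Finset.sum_range_succ', Finset.sum_range_succ'] at key
    replace key : ‖∑ k ∈ Finset.range r, (σ (n + k) * c (n + k)) • e (n + k) + (1 * t) • x'‖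
        ≤ C * ‖∑ k ∈ Finset.range r, c (n + k) • e (n + k) + t • x'‖ := key
    rw [one_mul, htx] at key
    rw [Finset.sum_range_add, Finset.sum_range_add, hhead, ← hx, add_comm x, add_comm x]
    exact key
  · cases k with
    | zero =>
      intro hk
      have := hchange (n - 1) (by
        rw [Nat.sub_add_cancel hn, hσn (n - 1) (by omega)]; exact hk)
      rwa [Nat.sub_add_cancel hn] at this
    | succ k => exact hchange (n + k)

/-- Blocks of `e` with a gap of at least one index between consecutive ones form an unconditional
sequence. The prepended vector only serves as an unused first block. -/
theorem norm_sum_sign_smul_block_le_of_prepend {X : Type*} [NormedAddCommGroup X]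
    [NormedSpace ℝ X] {C : ℝ} {e : ℕ → X} {n : ℕ} {x : X}
    (h : IsSkippedUnconditional C (prependSeq x (fun k => e (n + k))))
    (L : ℕ → ℕ) (hL0 : n + 1 ≤ L 0) (hL : ∀ j, L j + 2 ≤ L (j + 1)) (v : ℕ → X)
    (hv : ∀ j, v j ∈ Submodule.span ℝ (e '' {i : ℕ | L j ≤ i ∧ i + 1 < L (j + 1)}))
    (ε : ℕ → ℝ) (hε : ∀ j, ε j = 1 ∨ ε j = -1) (J : ℕ) :
    ‖∑ j ∈ Finset.range J, ε j • v j‖ ≤ C * ‖∑ j ∈ Finset.range J, v j‖ := by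
  have hLn : ∀ j, n + 1 ≤ L j := by
    intro j
    induction j with
    | zero => exact hL0
    | succ j ih => have := hL j; omega
  have key := h (J + 1) (fun j => Nat.casesOn j 0 fun j => L j - n + 1) rfl (fun j _ => ?_)
    (fun j => Nat.casesOn j 0 v) (fun j _ => ?_) (fun j => Nat.casesOn j 1 ε)
    (fun j => by cases j <;> simp [hε])
  · rw [Finset.sum_range_succ', Finset.sum_range_succ'] at key
    simpa using key
  · cases j with
    | zero => change 0 + 2 ≤ L 0 - n + 1; omega
    | succ j => simp only; have := hL j; have := hLn j; omega
  · cases j with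
    | zero => simp
    | succ j =>
      refine Submodule.span_mono ?_ (hv j)
      rintro _ ⟨i, ⟨h1, h2⟩, rfl⟩
      have := hLn j
      have := hL j
      refine ⟨i - n + 1, ⟨?_, ?_⟩, ?_⟩
      · simp only; omega
      · simp only; omega
      · simp only [prependSeq]; congr 1; omega

/-! ### Reflections -/

/-- The halving argument. The vector `z` has gaps at the points `g l` with `l` odd,
`0 < l < 2 ^ (m + 1)`, and coincides with `c` at those with `l` even and outside `[p, q]`. Flipping
`z` between consecutive pairs of gaps and averaging with `c` gives a vector of the same kind for the
points `g (2 * l)`, with half as many gaps and half the excess norm. When a single gap is left,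
flipping everything beyond it gives the reflected vector. -/
theorem exists_reflection_of_sign_changes {X : Type*} [NormedAddCommGroup X] [NormedSpace ℝ X]
    {C : ℝ} (hC1 : 1 ≤ C) {e : ℕ → X} {R n : ℕ}
    (hC : ∀ c σ : ℕ → ℝ, (∀ i, σ i = 1 ∨ σ i = -1) → (∀ i < n, σ i = 1) →
      (∀ i, σ (i + 1) ≠ σ i → c (i + 1) = 0) →
      ‖∑ i ∈ Finset.range R, (σ i * c i) • e i‖ ≤ C * ‖∑ i ∈ Finset.range R, c i • e i‖)
    (c : ℕ → ℝ) {p q : ℕ} (hnp : n ≤ p) (m : ℕ) :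
    ∀ g : ℕ → ℕ, StrictMono g → p ≤ g 1 → g (2 ^ (m + 1) - 1) ≤ q → ∀ z : ℕ → ℝ,
      (∀ l < 2 ^ m, z (g (2 * l + 1)) = 0) →
      (∀ l < 2 ^ m, 0 < l → z (g (2 * l)) = c (g (2 * l))) →
      (∀ i < p, z i = c i) → (∀ i, q < i → z i = c i) →
      ∃ w : ℕ → ℝ, ‖∑ i ∈ Finset.range R, w i • e i‖ ≤
          C ^ (m + 1) * ((1 - (1 / 2) ^ m) * ‖∑ i ∈ Finset.range R, c i • e i‖
            + (1 / 2) ^ m * ‖∑ i ∈ Finset.range R, z i • e i‖) ∧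
        (∀ i < p, w i = c i) ∧ ∀ i, q < i → w i = -c i := by
  classical
  have hC0 : 0 ≤ C := by linarith
  -- `N i` counts the gaps up to `i`, so that `(-1) ^ N i` changes sign exactly at the gaps
  have hN : ∀ (k : ℕ) (g : ℕ → ℕ), StrictMono g → p ≤ g 1 → g (2 * k - 1) ≤ q →
      ∃ N : ℕ → ℕ, (∀ i < p, N i = 0) ∧ (∀ i, q < i → N i = k) ∧ (∀ l < k, N (g (2 * l)) = l) ∧
      ∀ i, N (i + 1) ≠ N i → ∃ l < k, i + 1 = g (2 * l + 1) := by
    intro k g hg hp hq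
    obtain ⟨N, hNdef⟩ : ∃ N : ℕ → ℕ,
        ∀ i, N i = ((Finset.range k).filter fun l => g (2 * l + 1) ≤ i).card := ⟨_, fun _ => rfl⟩
    refine ⟨N, fun i hi => ?_, fun i hi => ?_, fun l hl => ?_, fun i hi => ?_⟩
    · rw [hNdef, Finset.card_eq_zero, Finset.filter_eq_empty_iff]
      intro l _ hl
      have := hg.monotone (show 1 ≤ 2 * l + 1 by omega)
      omega
    · rw [hNdef, Finset.filter_true_of_mem, Finset.card_range]
      intro l hl
      rw [Finset.mem_range] at hl
      have := hg.monotone (show 2 * l + 1 ≤ 2 * k - 1 by omega)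
      omega
    · have : ((Finset.range k).filter fun j => g (2 * j + 1) ≤ g (2 * l)) = Finset.range l := by
        ext j
        simp only [Finset.mem_filter, Finset.mem_range, hg.le_iff_le]
        omega
      rw [hNdef, this, Finset.card_range]
    · by_contra hne
      push Not at hne
      refine hi ?_
      rw [hNdef, hNdef]
      congr 1
      ext l
      simp only [Finset.mem_filter, Finset.mem_range]
      refine and_congr_right fun hl => ?_
      have := hne l hl
      omega
  induction m with
  | zero =>
    intro g hg hp hq z hz0 _ hzp hzq
    obtain ⟨N, h1, h2, _, h4⟩ := hN 1 g hg hp (by simpa using hq)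
    refine ⟨fun i => (-1) ^ N i * z i, ?_, fun i hi => ?_, fun i hi => ?_⟩
    · have := hC z (fun i => (-1) ^ N i) (fun i => neg_one_pow_eq_or ℝ _)
        (fun i hi => by rw [h1 i (by omega), pow_zero]) (fun i hi => ?_)
      · simpa using this
      · obtain ⟨l, hl, hil⟩ := h4 i (fun heq => hi (by rw [heq]))
        rw [hil]; exact hz0 l (by simpa using hl)
    · simp only; rw [h1 i hi, hzp i hi]; simp
    · simp only; rw [h2 i hi, hzq i hi]; simp
  | succ m ih =>
    intro g hg hp hq z hz0 hz1 hzp hzq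
    obtain ⟨N, h1, h2, h3, h4⟩ := hN (2 ^ (m + 1)) g hg hp (by rwa [← pow_succ'])
    set σ : ℕ → ℝ := fun i => (-1) ^ N i with hσ
    have hflip := hC z σ (fun i => neg_one_pow_eq_or ℝ _)
        (fun i hi => by simp only [hσ]; rw [h1 i (by omega), pow_zero]) (fun i hi => by
          obtain ⟨l, hl, hil⟩ := h4 i (fun heq => hi (by simp only [hσ]; rw [heq]))
          rw [hil]; exact hz0 l hl)
    have hpow : 2 ^ (m + 1) = 2 * 2 ^ m := pow_succ' 2 m
    have hpow2 : 2 ^ (m + 1 + 1) = 4 * 2 ^ m := by rw [pow_succ', pow_succ']; ring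
    have hpos : 0 < 2 ^ m := by positivity
    -- averaging with `c` kills the points at which the flipped vector is `-c`
    have key := ih (fun l => g (2 * l)) (fun a b hab => hg (by omega))
      (hp.trans (hg.monotone (by omega)))
      ((hg.monotone (by omega : 2 * (2 ^ (m + 1) - 1) ≤ 2 ^ (m + 1 + 1) - 1)).trans hq)
      (fun i => (c i + σ i * z i) / 2) (fun l hl => ?_) (fun l hl hl0 => ?_)
      (fun i hi => ?_) (fun i hi => ?_)
    · obtain ⟨w, hw, hwp, hwq⟩ := key
      refine ⟨w, hw.trans ?_, hwp, hwq⟩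
      set x := ∑ i ∈ Finset.range R, c i • e i
      set y := ∑ i ∈ Finset.range R, z i • e i
      have hz' : ‖∑ i ∈ Finset.range R, ((c i + σ i * z i) / 2) • e i‖
          ≤ (‖x‖ + C * ‖y‖) / 2 := by
        have : ∑ i ∈ Finset.range R, ((c i + σ i * z i) / 2) • e i
            = (1 / 2 : ℝ) • (x + ∑ i ∈ Finset.range R, (σ i * z i) • e i) := by
          rw [← Finset.sum_add_distrib, Finset.smul_sum]
          exact Finset.sum_congr rfl fun i _ => by module
        rw [this, norm_smul]
        have := norm_add_le x (∑ i ∈ Finset.range R, (σ i * z i) • e i)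
        norm_num
        linarith
      have hm1 : (1 / 2 : ℝ) ^ m ≤ 1 := pow_le_one₀ (by norm_num) (by norm_num)
      have hm0 : (0 : ℝ) ≤ (1 / 2 : ℝ) ^ m := by positivity
      calc C ^ (m + 1) * ((1 - (1 / 2) ^ m) * ‖x‖ + (1 / 2) ^ m *
            ‖∑ i ∈ Finset.range R, ((c i + σ i * z i) / 2) • e i‖)
          ≤ C ^ (m + 1) * ((1 - (1 / 2) ^ m) * ‖x‖ + (1 / 2) ^ m * ((‖x‖ + C * ‖y‖) / 2)) := by
            gcongr
        _ ≤ C ^ (m + 1) * (C * ((1 - (1 / 2) ^ m) * ‖x‖ + (1 / 2) ^ m * ((‖x‖ + ‖y‖) / 2))) := by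
            gcongr
            have hx := norm_nonneg x
            have h5 : 0 ≤ (C - 1) * ((1 - (1 / 2 : ℝ) ^ m) * ‖x‖) :=
              mul_nonneg (by linarith) (mul_nonneg (by linarith) hx)
            have h6 : 0 ≤ (C - 1) * ((1 / 2 : ℝ) ^ m * ‖x‖) :=
              mul_nonneg (by linarith) (mul_nonneg hm0 hx)
            linarith
        _ = C ^ (m + 1 + 1) * ((1 - (1 / 2) ^ (m + 1)) * ‖x‖ + (1 / 2) ^ (m + 1) * ‖y‖) := by
            rw [pow_succ C (m + 1), pow_succ (1 / 2 : ℝ) m]; ring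
    · have hs : σ (g (2 * (2 * l + 1))) = -1 := by
        simp only [hσ]; rw [h3 _ (by omega)]; exact Odd.neg_one_pow ⟨l, rfl⟩
      rw [hs, hz1 (2 * l + 1) (by omega) (by omega)]; ring
    · have hs : σ (g (2 * (2 * l))) = 1 := by
        simp only [hσ]; rw [h3 _ (by omega)]; exact Even.neg_one_pow ⟨l, by ring⟩
      rw [hs, hz1 (2 * l) (by omega) (by omega)]; ring
    · have hs : σ i = 1 := by simp only [hσ]; rw [h1 i hi, pow_zero]
      rw [hs, hzp i hi]; ring
    · have hs : σ i = 1 := by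
        simp only [hσ]; rw [h2 i hi]; exact Even.neg_one_pow ⟨2 ^ m, by omega⟩
      rw [hs, hzq i hi]; ring

/-! ### Copies of `ℓ₁` and shrinking bases -/

theorem containsCopyOfEllOne_of_lower_estimate {X : Type*} [NormedAddCommGroup X]
    [NormedSpace ℝ X] [CompleteSpace X] (v : ℕ → X) (hv : ∀ j, ‖v j‖ ≤ 1) {c : ℝ} (hc : 0 < c)
    (h : ∀ (J : ℕ) (a : ℕ → ℝ),
      c * ∑ j ∈ Finset.range J, |a j| ≤ ‖∑ j ∈ Finset.range J, a j • v j‖) :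
    ContainsCopyOfEllOne X := by
  have hnorm : ∀ a : lp (fun _ : ℕ => ℝ) 1, HasSum (fun j => |a j|) ‖a‖ := fun a => by
    simpa using lp.hasSum_norm (by norm_num) a
  have hle : ∀ (a : lp (fun _ : ℕ => ℝ) 1) j, ‖a j • v j‖ ≤ |a j| := fun a j => by
    rw [norm_smul]
    exact mul_le_of_le_one_right (norm_nonneg _) (hv j)
  have hsum : ∀ a : lp (fun _ : ℕ => ℝ) 1, Summable (fun j => a j • v j) := fun a =>
    Summable.of_norm_bounded (hnorm a).summable (hle a)
  let T : lp (fun _ : ℕ => ℝ) 1 →ₗ[ℝ] X :=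
    { toFun := fun a => ∑' j, a j • v j
      map_add' := fun a a' => by
        rw [← (hsum a).tsum_add (hsum a')]
        exact tsum_congr fun j => by simp [add_smul]
      map_smul' := fun t a => by
        simp only [RingHom.id_apply]
        rw [← (hsum a).tsum_const_smul]
        exact tsum_congr fun j => by simp [mul_smul] }
  refine ⟨T.mkContinuous 1 fun a => ?_, c, hc, fun a => ?_⟩
  · rw [one_mul]
    exact tsum_of_norm_bounded (hnorm a) (hle a)
  · have h1 := ((hnorm a).tendsto_sum_nat).const_mul c
    have h2 := ((hsum a).hasSum.tendsto_sum_nat).norm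
    exact le_of_tendsto_of_tendsto' h1 h2 fun J => h J _

theorem exists_mem_span_image_Ico {X : Type*} [AddCommGroup X] [Module ℝ X] (e : ℕ → X) (L : ℕ)
    {v : X} (hv : v ∈ Submodule.span ℝ (e '' {i | L ≤ i})) :
    ∃ R, L + 2 ≤ R ∧ v ∈ Submodule.span ℝ (e '' {i | L ≤ i ∧ i + 1 < R}) := by
  have hmono : ∀ {R R' : ℕ}, R ≤ R' → Submodule.span ℝ (e '' {i | L ≤ i ∧ i + 1 < R})
      ≤ Submodule.span ℝ (e '' {i | L ≤ i ∧ i + 1 < R'}) := fun {R R'} hR =>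
    Submodule.span_mono (Set.image_mono fun i hi => ⟨hi.1, hi.2.trans_le hR⟩)
  induction hv using Submodule.span_induction with
  | mem x hx =>
    obtain ⟨i, hi, rfl⟩ := hx
    exact ⟨i + 2, by simpa using hi, Submodule.subset_span ⟨i, ⟨hi, by omega⟩, rfl⟩⟩
  | zero => exact ⟨L + 2, le_rfl, Submodule.zero_mem _⟩
  | add x y _ _ hx hy =>
    obtain ⟨R, hR, hx⟩ := hx
    obtain ⟨R', hR', hy⟩ := hy
    exact ⟨max R R', hR.trans (le_max_left _ _),
      Submodule.add_mem _ (hmono (le_max_left _ _) hx) (hmono (le_max_right _ _) hy)⟩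
  | smul t x _ hx =>
    obtain ⟨R, hR, hx⟩ := hx
    exact ⟨R, hR, Submodule.smul_mem _ _ hx⟩

/-- An asymptotically skipped `1`-unconditional basis of a space without `ℓ₁` is shrinking: every
functional is small on the tails of the basis. -/
theorem exists_forall_abs_le_of_not_containsCopyOfEllOne {X : Type*} [NormedAddCommGroup X]
    [NormedSpace ℝ X] [CompleteSpace X] {e : ℕ → X} (he : ∀ k, e k ≠ 0)
    (hskip : IsAsymptoticallySkippedOneUnconditional e) (hX : ¬ ContainsCopyOfEllOne X)
    (f : StrongDual ℝ X) {κ : ℝ} (hκ : 0 < κ) :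
    ∃ L, ∀ v ∈ Submodule.span ℝ (e '' {i | L ≤ i}), |f v| ≤ κ * ‖v‖ := by
  by_contra hcon
  push Not at hcon
  have hunit : ∀ L, ∃ v ∈ Submodule.span ℝ (e '' {i | L ≤ i}), ‖v‖ = 1 ∧ κ ≤ f v := by
    intro L
    obtain ⟨v, hv, hlt⟩ := hcon L
    have hv0 : 0 < ‖v‖ := norm_pos_iff.2 fun h => by simp [h] at hlt
    have hκ' : κ ≤ ‖v‖⁻¹ * |f v| := by
      rw [inv_mul_eq_div, le_div_iff₀ hv0]; exact hlt.le
    rcases abs_cases (f v) with ⟨h, _⟩ | ⟨h, _⟩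
    · refine ⟨‖v‖⁻¹ • v, Submodule.smul_mem _ _ hv, ?_, ?_⟩
      · rw [norm_smul, norm_inv, norm_norm, inv_mul_cancel₀ hv0.ne']
      · rw [map_smul, smul_eq_mul, ← h]; exact hκ'
    · refine ⟨-(‖v‖⁻¹ • v), Submodule.neg_mem _ (Submodule.smul_mem _ _ hv), ?_, ?_⟩
      · rw [norm_neg, norm_smul, norm_inv, norm_norm, inv_mul_cancel₀ hv0.ne']
      · rw [map_neg, map_smul, smul_eq_mul, ← mul_neg, ← h]; exact hκ'
  choose V hVmem hV1 hVf using hunit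
  choose S hS hSmem using fun L => exists_mem_span_image_Ico e L (hVmem L)
  obtain ⟨n, hn, h⟩ := hskip 2 (by norm_num)
  have h0 := h (e 0) (Submodule.subset_span ⟨0, by simp; omega, rfl⟩) (he 0)
  -- the `j`-th block starts at `P j` and leaves a gap before `P (j + 1)`
  set P : ℕ → ℕ := fun j => Nat.rec (n + 1) (fun _ k => S k) j with hP
  have hf0 : 0 < ‖f‖ := by
    have := f.le_opNorm (V 0)
    rw [hV1, mul_one] at this
    have := (le_abs_self _).trans this
    linarith [hVf 0]
  refine hX (containsCopyOfEllOne_of_lower_estimate (fun j => V (P j)) (fun j => (hV1 _).le)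
    (c := κ / (2 * ‖f‖)) (by positivity) fun J a => ?_)
  have hsign := norm_sum_sign_smul_block_le_of_prepend h0 P le_rfl (fun j => hS _)
    (fun j => a j • V (P j)) (fun j => Submodule.smul_mem _ _ (hSmem _))
    (fun j => if 0 ≤ a j then 1 else -1) (fun j => by by_cases h : 0 ≤ a j <;> simp [h]) J
  have habs : ∀ j, (if 0 ≤ a j then (1 : ℝ) else -1) • a j • V (P j) = |a j| • V (P j) := by
    intro j
    split_ifs with h
    · rw [abs_of_nonneg h, one_smul]
    · rw [abs_of_neg (by linarith), neg_one_smul, neg_smul]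
  simp only [habs] at hsign
  have hlow : κ * ∑ j ∈ Finset.range J, |a j|
      ≤ ‖f‖ * ‖∑ j ∈ Finset.range J, |a j| • V (P j)‖ := by
    refine le_trans ?_ ((le_abs_self _).trans (f.le_opNorm _))
    rw [map_sum, Finset.mul_sum]
    refine Finset.sum_le_sum fun j _ => ?_
    rw [map_smul, smul_eq_mul, mul_comm]
    exact mul_le_mul_of_nonneg_left (hVf _) (abs_nonneg _)
  rw [div_mul_eq_mul_div, div_le_iff₀ (by positivity)]
  calc _ ≤ _ := hlow
    _ ≤ ‖f‖ * (2 * ‖∑ j ∈ Finset.range J, a j • V (P j)‖) := by gcongr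
    _ = _ := by ring

/-! ### Reflections of finite vectors and property `(au*)` -/

theorem SchauderBasis.coord_sum_range {X : Type*} [NormedAddCommGroup X] [NormedSpace ℝ X]
    (b : SchauderBasis ℝ X) (R : ℕ) (c : ℕ → ℝ) {i : ℕ} (hi : i < R) :
    b.coord i (∑ j ∈ Finset.range R, c j • b j) = c i := by
  simp [b.ortho, Pi.single_apply, hi]

/-- For each tolerance `η` and each `L` there is `M` such that every finite vector in the unit ball
can be modified on the coordinates in `[L, M)`, and negated from `M` on, so that its norm stays at
most `1 + η`. Finite vectors are given by their coefficients; only lengths `R ≥ M` are considered,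
which loses nothing as coefficients may vanish. -/
def HasAsymptoticReflections {X : Type*} [NormedAddCommGroup X] [NormedSpace ℝ X]
    (b : SchauderBasis ℝ X) : Prop :=
  ∀ η : ℝ, 0 < η → ∀ L : ℕ, ∃ M : ℕ, ∀ R, M ≤ R → ∀ c : ℕ → ℝ,
    ‖∑ i ∈ Finset.range R, c i • b i‖ ≤ 1 →
      ∃ w : ℕ → ℝ, ‖∑ i ∈ Finset.range R, w i • b i‖ ≤ 1 + η ∧
        (∀ i < L, w i = c i) ∧ ∀ i, M ≤ i → w i = -c i

/-- If `y` is a reflection of a vector `x`, then `(f - g n) y` is close to `(f + g n) x`: `x - y`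
lives beyond `L`, where `f` is small, and `x + y` lives before `M`, where `g n` is eventually small.
-/
theorem HasAsymptoticReflections.eventually_norm_add_le {X : Type*} [NormedAddCommGroup X]
    [NormedSpace ℝ X] [CompleteSpace X] {b : SchauderBasis ℝ X} (hb : HasAsymptoticReflections b)
    (f : StrongDual ℝ X)
    (hf : ∀ κ : ℝ, 0 < κ →
      ∃ L, ∀ v ∈ Submodule.span ℝ ((fun k => b k) '' {i | L ≤ i}), |f v| ≤ κ * ‖v‖)
    (g : ℕ → StrongDual ℝ X) (hg : ∀ x, Tendsto (fun n => g n x) atTop (𝓝 0))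
    {δ : ℝ} (hδ : 0 < δ) : ∀ᶠ n in atTop, ‖f + g n‖ ≤ ‖f - g n‖ + δ := by
  obtain ⟨D, hD⟩ := banach_steinhaus (g := g) fun x => by
    obtain ⟨D, hD⟩ := isBounded_iff_forall_norm_le.1 (Metric.isBounded_range_of_tendsto _ (hg x))
    exact ⟨D, fun n => hD _ ⟨n, rfl⟩⟩
  have hD0 : 0 ≤ D := (norm_nonneg _).trans (hD 0)
  set A := ‖f‖ + D with hA
  have hA0 : 0 ≤ A := by positivity
  obtain ⟨L, hL⟩ := hf (δ / 12) (by positivity)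
  obtain ⟨η, hη0, hη1, hηA⟩ : ∃ η : ℝ, 0 < η ∧ η ≤ 1 ∧ η * A ≤ δ / 2 := by
    refine ⟨min 1 (δ / (2 * (A + 1))), by positivity, min_le_left _ _, ?_⟩
    calc _ ≤ δ / (2 * (A + 1)) * (A + 1) := by gcongr; exacts [min_le_right _ _, by linarith]
      _ = δ / 2 := by field_simp
  obtain ⟨M, hM⟩ := hb η hη0 L
  have hτ : Tendsto (fun n => ∑ i ∈ Finset.range M, ‖b.coord i‖ * |g n (b i)|) atTop (𝓝 0) := by
    have : Tendsto (fun n => ∑ i ∈ Finset.range M, ‖b.coord i‖ * |g n (b i)|) atTop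
        (𝓝 (∑ i ∈ Finset.range M, ‖b.coord i‖ * |(0 : ℝ)|)) :=
      tendsto_finsetSum _ fun i _ => ((hg (b i)).abs).const_mul _
    simpa using this
  filter_upwards [hτ.eventually (gt_mem_nhds (show 0 < δ / 12 by positivity))] with n hn
  have hfg : ‖f - g n‖ ≤ A := (norm_sub_le _ _).trans (by have := hD n; linarith)
  -- the estimate on finite vectors of norm at most one
  have hfin : ∀ R, M ≤ R → ∀ c : ℕ → ℝ, ‖∑ i ∈ Finset.range R, c i • b i‖ ≤ 1 →
      (f + g n) (∑ i ∈ Finset.range R, c i • b i) ≤ ‖f - g n‖ + δ := by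
    intro R hR c hc
    obtain ⟨w, hw, hwL, hwM⟩ := hM R hR c hc
    set x := ∑ i ∈ Finset.range R, c i • b i with hx
    set y := ∑ i ∈ Finset.range R, w i • b i with hy
    have h1 : |f (x - y)| ≤ δ / 4 := by
      refine (hL _ ?_).trans ?_
      · rw [hx, hy, ← Finset.sum_sub_distrib]
        refine Submodule.sum_mem _ fun i _ => ?_
        rw [← sub_smul]
        rcases Nat.lt_or_ge i L with h | h
        · simp [hwL i h]
        · exact Submodule.smul_mem _ _ (Submodule.subset_span ⟨i, h, rfl⟩)
      · have := norm_sub_le x y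
        calc _ ≤ δ / 12 * 3 := by gcongr; linarith
          _ = δ / 4 := by ring
    have h2 : |g n (x + y)| ≤ δ / 4 := by
      have hxy : x + y = ∑ i ∈ Finset.range R, (c i + w i) • b i := by
        rw [hx, hy, ← Finset.sum_add_distrib]
        exact Finset.sum_congr rfl fun i _ => (add_smul _ _ _).symm
      have hg1 : g n (x + y) = ∑ i ∈ Finset.range M, (c i + w i) * g n (b i) := by
        rw [hxy, map_sum]
        symm
        refine (Finset.sum_congr rfl fun i _ => ?_).trans
          (Finset.sum_subset (Finset.range_mono hR) fun i _ hi => ?_)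
        · rw [map_smul, smul_eq_mul]
        · rw [Finset.mem_range, not_lt] at hi
          simp [hwM i hi]
      have hg2 : |g n (x + y)|
          ≤ (∑ i ∈ Finset.range M, ‖b.coord i‖ * |g n (b i)|) * ‖x + y‖ := by
        rw [hg1, Finset.sum_mul]
        refine (Finset.abs_sum_le_sum_abs _ _).trans (Finset.sum_le_sum fun i hi => ?_)
        have hci : b.coord i (x + y) = c i + w i := by
          rw [hxy]
          exact b.coord_sum_range R _ ((Finset.mem_range.1 hi).trans_le hR)
        have := (b.coord i).le_opNorm (x + y)
        rw [hci, Real.norm_eq_abs] at this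
        rw [abs_mul, mul_right_comm]
        gcongr
      have := norm_add_le x y
      calc _ ≤ _ := hg2
        _ ≤ δ / 12 * 3 := by gcongr; linarith
        _ = δ / 4 := by ring
    have h3 : (f - g n) y ≤ ‖f - g n‖ + δ / 2 :=
      calc (f - g n) y ≤ ‖f - g n‖ * ‖y‖ := (le_abs_self _).trans ((f - g n).le_opNorm y)
        _ ≤ ‖f - g n‖ * (1 + η) := by gcongr
        _ = ‖f - g n‖ + η * ‖f - g n‖ := by ring
        _ ≤ ‖f - g n‖ + η * A := by gcongr
        _ ≤ _ := by linarith
    have h4 : (f + g n) x = (f - g n) y + f (x - y) + g n (x + y) := by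
      simp only [add_apply, sub_apply, map_sub, map_add]; ring
    have := le_abs_self (f (x - y))
    have := le_abs_self (g n (x + y))
    linarith
  have hB : 0 ≤ ‖f - g n‖ + δ := by positivity
  have hhom : ∀ R, M ≤ R → ∀ x, (f + g n) (b.proj R x) ≤ (‖f - g n‖ + δ) * ‖b.proj R x‖ := by
    intro R hR x
    rcases eq_or_ne (b.proj R x) 0 with h | h
    · simp [h]
    · have hpos := norm_pos_iff.2 h
      have heq : ∑ i ∈ Finset.range R, (‖b.proj R x‖⁻¹ * b.coord i x) • b i
          = ‖b.proj R x‖⁻¹ • b.proj R x := by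
        simp only [mul_smul, ← Finset.smul_sum, SchauderBasis.proj_apply]
      have := hfin R hR (fun i => ‖b.proj R x‖⁻¹ * b.coord i x) (by
        rw [heq, norm_smul, norm_inv, norm_norm, inv_mul_cancel₀ hpos.ne'])
      rwa [heq, map_smul, smul_eq_mul, inv_mul_le_iff₀ hpos, mul_comm] at this
  have hall : ∀ x, (f + g n) x ≤ (‖f - g n‖ + δ) * ‖x‖ := fun x =>
    le_of_tendsto_of_tendsto (((f + g n).continuous.tendsto x).comp (b.tendsto_proj x))
      ((b.tendsto_proj x).norm.const_mul _)
      ((eventually_ge_atTop M).mono fun R hR => hhom R hR x)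
  refine ContinuousLinearMap.opNorm_le_bound _ hB fun x => abs_le.2 ⟨?_, hall x⟩
  have := hall (-x)
  rw [map_neg, norm_neg] at this
  linarith

theorem HasAsymptoticReflections.propertyAUStar {X : Type*} [NormedAddCommGroup X]
    [NormedSpace ℝ X] [CompleteSpace X] {b : SchauderBasis ℝ X} (hb : HasAsymptoticReflections b)
    (hf : ∀ (f : StrongDual ℝ X) (κ : ℝ), 0 < κ →
      ∃ L, ∀ v ∈ Submodule.span ℝ ((fun k => b k) '' {i | L ≤ i}), |f v| ≤ κ * ‖v‖) :
    PropertyAUStar X := by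
  intro f g hg
  have hg' : ∀ x, Tendsto (fun n => g n x) atTop (𝓝 0) := fun x =>
    ((WeakDual.eval_continuous x).tendsto _).comp hg
  rw [Metric.tendsto_atTop]
  intro δ hδ
  rw [← eventually_atTop]
  filter_upwards [hb.eventually_norm_add_le f (hf f) g hg' (half_pos hδ),
    hb.eventually_norm_add_le f (hf f) (fun n => -g n)
      (fun x => by simpa using (hg' x).neg) (half_pos hδ)] with n h1 h2
  rw [← sub_eq_add_neg, sub_neg_eq_add] at h2
  rw [Real.dist_eq, sub_zero, abs_lt]
  constructor <;> linarith

/-! ### Reflections from cheap removal of coordinates -/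

theorem exists_one_lt_pow_mul_le {x y : ℝ} (hxy : x < y) (k : ℕ) :
    ∃ C : ℝ, 1 < C ∧ C ≤ 2 ∧ C ^ k * x ≤ y := by
  have h1 : Tendsto (fun C : ℝ => C ^ k * x) (𝓝[>] 1) (𝓝 x) := by
    have : Tendsto (fun C : ℝ => C ^ k * x) (𝓝 1) (𝓝 ((1 : ℝ) ^ k * x)) :=
      (by fun_prop : Continuous fun C : ℝ => C ^ k * x).tendsto 1
    rw [one_pow, one_mul] at this
    exact this.mono_left nhdsWithin_le_nhds
  obtain ⟨C, h2, h3, h4⟩ := ((h1.eventually (gt_mem_nhds hxy)).and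
    (((eventually_le_nhds (show (1 : ℝ) < 2 by norm_num)).filter_mono nhdsWithin_le_nhds).and
      self_mem_nhdsWithin)).exists
  exact ⟨C, h4, h3, h2.le⟩

/-- The halving argument applied to `z = c - y`, where `y` takes the values of `c` at the odd points
and has norm small compared with the number `2 ^ m` of gaps. -/
theorem exists_reflection_of_removal {X : Type*} [NormedAddCommGroup X] [NormedSpace ℝ X]
    {C : ℝ} (hC1 : 1 ≤ C) {e : ℕ → X} {R n : ℕ}
    (hC : ∀ c σ : ℕ → ℝ, (∀ i, σ i = 1 ∨ σ i = -1) → (∀ i < n, σ i = 1) →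
      (∀ i, σ (i + 1) ≠ σ i → c (i + 1) = 0) →
      ‖∑ i ∈ Finset.range R, (σ i * c i) • e i‖ ≤ C * ‖∑ i ∈ Finset.range R, c i • e i‖)
    {c y : ℕ → ℝ} {p q m : ℕ} (hnp : n ≤ p) {g : ℕ → ℕ} (hg : StrictMono g) (hp : p ≤ g 1)
    (hq : g (2 ^ (m + 1) - 1) ≤ q) (hodd : ∀ l < 2 ^ m, y (g (2 * l + 1)) = c (g (2 * l + 1)))
    (heven : ∀ l < 2 ^ m, 0 < l → y (g (2 * l)) = 0) (hyp : ∀ i < p, y i = 0)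
    (hyq : ∀ i, q < i → y i = 0) {η : ℝ} (hCη : C ^ (m + 1) * (1 + η / 2) ≤ 1 + η)
    (hc : ‖∑ i ∈ Finset.range R, c i • e i‖ ≤ 1)
    (hy : ‖∑ i ∈ Finset.range R, y i • e i‖ ≤ η / 2 * 2 ^ m) :
    ∃ w : ℕ → ℝ, ‖∑ i ∈ Finset.range R, w i • e i‖ ≤ 1 + η ∧
      (∀ i < p, w i = c i) ∧ ∀ i, q < i → w i = -c i := by
  obtain ⟨w, hw, h⟩ := exists_reflection_of_sign_changes hC1 hC c hnp m g hg hp hq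
    (fun i => c i - y i) (fun l hl => by simp [hodd l hl])
    (fun l hl hl0 => by simp [heven l hl hl0]) (fun i hi => by simp [hyp i hi])
    (fun i hi => by simp [hyq i hi])
  refine ⟨w, hw.trans (le_trans ?_ hCη), h⟩
  have hz : ‖∑ i ∈ Finset.range R, (c i - y i) • e i‖ ≤ 1 + η / 2 * 2 ^ m := by
    simp only [sub_smul, Finset.sum_sub_distrib]
    exact (norm_sub_le _ _).trans (add_le_add hc hy)
  have hm1 : (1 / 2 : ℝ) ^ m ≤ 1 := pow_le_one₀ (by norm_num) (by norm_num)
  have hm2 : (1 / 2 : ℝ) ^ m * 2 ^ m = 1 := by rw [← mul_pow]; norm_num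
  refine mul_le_mul_of_nonneg_left ?_ (pow_nonneg (by linarith) _)
  calc _ ≤ (1 - (1 / 2 : ℝ) ^ m) * 1 + (1 / 2) ^ m * (1 + η / 2 * 2 ^ m) := by gcongr
    _ = 1 + η / 2 * ((1 / 2 : ℝ) ^ m * 2 ^ m) := by ring
    _ = 1 + η / 2 := by rw [hm2, mul_one]

theorem SchauderBasis.exists_norm_coord_le {X : Type*} [NormedAddCommGroup X] [NormedSpace ℝ X]
    [CompleteSpace X] (b : SchauderBasis ℝ X) (hnorm : ∀ k, ‖b k‖ = 1) :
    ∃ A : ℝ, 0 < A ∧ (∀ i x, |b.coord i x| ≤ A * ‖x‖) ∧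
      ∀ p q x, ‖b.proj q x - b.proj p x‖ ≤ A * ‖x‖ := by
  obtain ⟨K, hK⟩ := b.exists_norm_proj_le
  have hK0 : 0 ≤ K := (norm_nonneg _).trans (hK 0)
  have h : ∀ p q x, ‖b.proj q x - b.proj p x‖ ≤ (2 * K + 1) * ‖x‖ := fun p q x => by
    have h1 := (b.proj q).le_of_opNorm_le (hK q) x
    have h2 := (b.proj p).le_of_opNorm_le (hK p) x
    have := norm_sub_le (b.proj q x) (b.proj p x)
    nlinarith [norm_nonneg x]
  refine ⟨2 * K + 1, by positivity, fun i x => ?_, h⟩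
  have := h i (i + 1) x
  rwa [SchauderBasis.proj_apply, SchauderBasis.proj_apply, Finset.sum_range_succ,
    add_sub_cancel_left, norm_smul, hnorm, mul_one] at this

/-- If sums of `2 ^ m` basis vectors along a subsequence have norm `o(2 ^ m)`, with every other
index skipped, then the coordinates at these places can be removed cheaply. -/
theorem hasAsymptoticReflections_of_small_sums {X : Type*} [NormedAddCommGroup X]
    [NormedSpace ℝ X] [CompleteSpace X] (b : SchauderBasis ℝ X) (hnorm : ∀ k, ‖b k‖ = 1)
    (hskip : IsAsymptoticallySkippedOneUnconditional (fun k => b k)) {φ : ℕ → ℕ}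
    (hφ : StrictMono φ)
    (h : ∀ ε : ℝ, 0 < ε → ∃ m : ℕ, ∀ N₀, ∃ N, N₀ ≤ N ∧
      ‖∑ l ∈ Finset.range (2 ^ m), b (φ (N + (2 * l + 1)))‖ ≤ ε * 2 ^ m) :
    HasAsymptoticReflections b := by
  classical
  have hne : ∀ k, b k ≠ 0 := fun k h => by simpa [h] using hnorm k
  obtain ⟨A, hA, hcoord, -⟩ := b.exists_norm_coord_le hnorm
  intro η hη L
  obtain ⟨m, hm⟩ := h (η / (4 * A)) (by positivity)
  obtain ⟨C, hC1, hC2, hCη⟩ := exists_one_lt_pow_mul_le (show 1 + η / 2 < 1 + η by linarith) (m + 1)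
  obtain ⟨n, hn, hCn⟩ := hskip C hC1
  obtain ⟨N, hN, hsmall⟩ := hm (max L (n + 1))
  set g : ℕ → ℕ := fun l => φ (N + l) with hgdef
  have hg : StrictMono g := fun i j hij => hφ (by omega)
  have hg1 : max L (n + 1) ≤ g 1 := (hN.trans (by omega : N ≤ N + 1)).trans (hφ.le_apply)
  refine ⟨g (2 ^ (m + 1) - 1) + 1, fun R hR c hc => ?_⟩
  have hnR : n ≤ R := by
    have := hg.monotone (show 1 ≤ 2 ^ (m + 1) - 1 by
      have : 2 ^ 1 ≤ 2 ^ (m + 1) := Nat.pow_le_pow_right (by norm_num) (by omega)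
      omega)
    omega
  have hlt : ∀ l < 2 ^ m, g (2 * l + 1) ≤ g (2 ^ (m + 1) - 1) := fun l hl =>
    hg.monotone (by rw [pow_succ']; omega)
  set s := (Finset.range (2 ^ m)).image fun l => g (2 * l + 1) with hs
  have hinj : Set.InjOn (fun l => g (2 * l + 1)) (Finset.range (2 ^ m)) :=
    fun i _ j _ hij => by have := hg.injective hij; omega
  have hmem : ∀ {i}, i ∈ s ↔ ∃ l < 2 ^ m, g (2 * l + 1) = i := by simp [hs]
  -- the removed coordinates are bounded by `A`, and unconditionality reduces them to equal ones
  have hsum : ‖∑ i ∈ Finset.range R, (if i ∈ s then c i else 0) • b i‖ ≤ η / 2 * 2 ^ m := by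
    have hcA : ∀ i < R, |c i| ≤ A := fun i hi => by
      have := hcoord i (∑ i ∈ Finset.range R, c i • b i)
      rw [b.coord_sum_range R c hi] at this
      exact this.trans (mul_le_of_le_one_right hA.le hc)
    have heq : ∑ i ∈ Finset.range R, (if i ∈ s then c i else 0) • b i
        = A • ∑ l ∈ Finset.range (2 ^ m), (c (g (2 * l + 1)) / A) • b (g (2 * l + 1)) := by
      simp only [ite_smul, zero_smul]
      rw [Finset.sum_ite_mem, Finset.inter_eq_right.2, hs, Finset.sum_image hinj, Finset.smul_sum]
      · refine Finset.sum_congr rfl fun l _ => ?_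
        rw [smul_smul, mul_div_cancel₀ _ hA.ne']
      · intro i hi
        obtain ⟨l, hl, rfl⟩ := hmem.1 hi
        have := hlt l hl
        rw [Finset.mem_range]; omega
    have hunc := norm_add_sum_smul_le_of_signs (B := 2 * (η / (4 * A) * 2 ^ m))
      (fun l => b (g (2 * l + 1))) (Finset.range (2 ^ m)) 0 (fun ε hε => by
        have := norm_sum_sign_smul_block_le_of_prepend
          (hCn (b 0) (Submodule.subset_span ⟨0, by simp; omega, rfl⟩) (hne 0))
          (fun l => g (2 * l + 1)) ((le_max_right _ _).trans hg1)
          (fun l => by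
            have h1 := hg (show 2 * l + 1 < 2 * l + 2 by omega)
            have h2 := hg (show 2 * l + 2 < 2 * (l + 1) + 1 by omega)
            omega) (fun l => b (g (2 * l + 1)))
          (fun l => Submodule.subset_span ⟨g (2 * l + 1), ⟨le_rfl, by
            have h1 := hg (show 2 * l + 1 < 2 * l + 2 by omega)
            have h2 := hg (show 2 * l + 2 < 2 * (l + 1) + 1 by omega)
            omega⟩, rfl⟩) ε hε (2 ^ m)
        rw [zero_add]
        exact this.trans (mul_le_mul hC2 hsmall (norm_nonneg _) (by norm_num)))
      (fun l => c (g (2 * l + 1)) / A) (fun l hl => by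
        have := hlt l (Finset.mem_range.1 hl)
        rw [abs_div, abs_of_pos hA, div_le_one hA]
        exact hcA _ (by omega))
    rw [zero_add] at hunc
    rw [heq, norm_smul, Real.norm_of_nonneg hA.le]
    calc _ ≤ A * (2 * (η / (4 * A) * 2 ^ m)) := by gcongr
      _ = _ := by field_simp; ring
  obtain ⟨w, hw, hwp, hwq⟩ := exists_reflection_of_removal hC1.le
    (fun c σ => norm_sum_sign_smul_le_of_prepend hn (hne 0) hCn R hnR c σ)
    (c := c) (y := fun i => if i ∈ s then c i else 0) (p := g 1)
    (by omega) hg le_rfl le_rfl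
    (fun l hl => if_pos (hmem.2 ⟨l, hl, rfl⟩))
    (fun l hl hl0 => if_neg fun hcon => by
      obtain ⟨k, _, hk⟩ := hmem.1 hcon
      have := hg.injective hk
      omega)
    (fun i hi => if_neg fun hcon => by
      obtain ⟨k, _, rfl⟩ := hmem.1 hcon
      exact absurd (hg.lt_iff_lt.1 hi) (by omega))
    (fun i hi => if_neg fun hcon => by
      obtain ⟨k, hk, rfl⟩ := hmem.1 hcon
      exact absurd (hlt k hk) (by omega)) hCη hc hsum
  exact ⟨w, hw, fun i hi => hwp i (by omega), fun i hi => hwq i (by omega)⟩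

/-! ### Unconditional subsequences of the biorthogonal functionals -/

/-- A form of Helly's theorem: finitely many functionals with a lower `ℓ₁`-estimate take any bounded
system of values at some vector of controlled norm. Separation gives approximate values, and the
biorthogonal vectors `u` correct the error. -/
theorem exists_apply_eq_of_lower_estimate {X : Type*} [NormedAddCommGroup X] [NormedSpace ℝ X]
    (F : ℕ → StrongDual ℝ X) (u : ℕ → X) (hu : ∀ i, ‖u i‖ ≤ 1)
    (hFu : ∀ i j, F i (u j) = if i = j then 1 else 0) (s : Finset ℕ) {β : ℝ} (hβ : 0 < β)
    (hF : ∀ a : ℕ → ℝ, β * ∑ i ∈ s, |a i| ≤ ‖∑ i ∈ s, a i • F i‖) {A : ℝ} (hA : 0 < A)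
    (t : ℕ → ℝ) (ht : ∀ i ∈ s, |t i| ≤ A) :
    ∃ x : X, ‖x‖ ≤ A / β + 1 ∧ ∀ i ∈ s, F i x = t i := by
  classical
  set r := A / β with hr
  have hr0 : 0 < r := by positivity
  let T : X →L[ℝ] (s → ℝ) := ContinuousLinearMap.pi fun i => F i
  set t' : s → ℝ := fun i => t i with ht'
  have hclos : t' ∈ closure (T '' Metric.closedBall 0 r) := by
    by_contra hnot
    obtain ⟨f, M, hf1, hf2⟩ := geometric_hahn_banach_closed_point
      (((convex_closedBall (0 : X) r).linear_image T.toLinearMap).closure) isClosed_closure hnot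
    set a : ℕ → ℝ := fun i => if h : i ∈ s then f (Pi.single ⟨i, h⟩ 1) else 0 with ha
    have hf : ∀ z : ℕ → ℝ, f (fun i : s => z i) = ∑ i ∈ s, z i * a i := by
      intro z
      rw [← Finset.sum_coe_sort, ← Finset.univ_sum_single (fun i : s => z i), map_sum]
      refine Finset.sum_congr rfl fun i _ => ?_
      rw [ha]
      simp only [Finset.coe_mem, dite_true]
      rw [← smul_eq_mul, ← map_smul]
      congr 1
      rw [← Pi.single_smul]
      simp
    have hball : ∀ x : X, ‖x‖ ≤ r → (∑ i ∈ s, a i • F i) x ≤ M := by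
      intro x hx
      have := hf1 (T x) (subset_closure ⟨x, by simpa using hx, rfl⟩)
      have h2 : f (T x) = ∑ i ∈ s, F i x * a i := hf fun i => F i x
      rw [h2] at this
      simp only [sum_apply, smul_apply, smul_eq_mul]
      refine le_trans (le_of_eq ?_) this.le
      exact Finset.sum_congr rfl fun i _ => mul_comm _ _
    have hM : 0 ≤ M := by simpa using hball 0 (by simpa using hr0.le)
    have hnormle : ‖∑ i ∈ s, a i • F i‖ ≤ M / r := by
      refine ContinuousLinearMap.opNorm_le_of_unit_norm (by positivity) fun x hx => ?_
      rw [le_div_iff₀ hr0, Real.norm_eq_abs]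
      have h1 := hball (r • x) (by rw [norm_smul, hx, mul_one, Real.norm_of_nonneg hr0.le])
      have h2 := hball (-(r • x))
        (by rw [norm_neg, norm_smul, hx, mul_one, Real.norm_of_nonneg hr0.le])
      rw [map_neg] at h2
      rw [map_smul, smul_eq_mul] at h1 h2
      rcases abs_cases ((∑ i ∈ s, a i • F i) x) with ⟨h, _⟩ | ⟨h, _⟩ <;> rw [h] <;> linarith
    have hft : f t' ≤ A * ∑ i ∈ s, |a i| := by
      rw [ht', hf, Finset.mul_sum]
      refine Finset.sum_le_sum fun i hi => (le_abs_self _).trans ?_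
      rw [abs_mul]
      exact mul_le_mul_of_nonneg_right (ht i hi) (abs_nonneg _)
    have h1 := (hF a).trans hnormle
    rw [le_div_iff₀ hr0] at h1
    have h2 : β * (∑ i ∈ s, |a i|) * r = A * ∑ i ∈ s, |a i| := by
      rw [hr]; field_simp
    linarith
  obtain ⟨_, ⟨x, hx, rfl⟩, hdist⟩ := Metric.mem_closure_iff.1 hclos (1 / (s.card + 1))
    (by positivity)
  have hcoordlt : ∀ i ∈ s, |t i - F i x| ≤ 1 / (s.card + 1) := fun i hi =>
    ((Real.dist_eq _ _).symm.le.trans (dist_le_pi_dist t' (T x) ⟨i, hi⟩)).trans hdist.le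
  refine ⟨x + ∑ j ∈ s, (t j - F j x) • u j, ?_, fun i hi => ?_⟩
  · refine (norm_add_le _ _).trans (add_le_add (by simpa using hx) ?_)
    calc ‖∑ j ∈ s, (t j - F j x) • u j‖ ≤ ∑ j ∈ s, (1 / (s.card + 1) : ℝ) := by
          refine norm_sum_le_of_le _ fun j hj => ?_
          rw [norm_smul]
          exact (mul_le_of_le_one_right (norm_nonneg _) (hu j)).trans (hcoordlt j hj)
      _ ≤ 1 := by
          rw [Finset.sum_const, nsmul_eq_mul, mul_one_div, div_le_one (by positivity)]
          linarith
  · simp [hFu, hi]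

/-- An unconditional subsequence of the coordinate functionals yields reflections. If `x` has all
its coordinates in a window bounded below in modulus, then evaluating at `x`, after a change of
signs, shows that these functionals satisfy a lower `ℓ₁`-estimate. -/
theorem hasAsymptoticReflections_of_isUnconditionalSeq_coord {X : Type*} [NormedAddCommGroup X]
    [NormedSpace ℝ X] [CompleteSpace X] (b : SchauderBasis ℝ X) (hnorm : ∀ k, ‖b k‖ = 1)
    (hskip : IsAsymptoticallySkippedOneUnconditional (fun k => b k)) {φ : ℕ → ℕ}
    (hφ : StrictMono φ) (h : IsUnconditionalSeq (fun k => b.coord (φ k))) :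
    HasAsymptoticReflections b := by
  classical
  have hne : ∀ k, b k ≠ 0 := fun k h => by simpa [h] using hnorm k
  obtain ⟨A, hA, hcoord, hproj⟩ := b.exists_norm_coord_le hnorm
  obtain ⟨D, hD1, hD⟩ : ∃ D : ℝ, 0 < D ∧ ∀ (s : Finset ℕ) (a ε : ℕ → ℝ),
      (∀ j, ε j = 1 ∨ ε j = -1) → ‖∑ j ∈ s, (ε j * a j) • b.coord (φ j)‖
        ≤ D * ‖∑ j ∈ s, a j • b.coord (φ j)‖ := by
    obtain ⟨-, D, hD⟩ := h
    exact ⟨max D 1, by positivity, fun s a ε hε => (hD s a ε hε).trans (by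
      gcongr; exact le_max_left _ _)⟩
  intro η hη L
  -- the bound on the vector to be subtracted does not involve the number of gaps
  obtain ⟨m, hm⟩ : ∃ m : ℕ, A * (A / (η / 2 / D) + 1) ≤ η / 2 * 2 ^ m := by
    obtain ⟨m, hm⟩ := pow_unbounded_of_one_lt (A * (A / (η / 2 / D) + 1) / (η / 2))
      (one_lt_two : (1 : ℝ) < 2)
    exact ⟨m, by rw [div_lt_iff₀' (by positivity)] at hm; exact hm.le⟩
  obtain ⟨C, hC1, -, hCη⟩ := exists_one_lt_pow_mul_le (show 1 + η / 2 < 1 + η by linarith) (m + 1)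
  obtain ⟨n, hn, hCn⟩ := hskip C hC1
  set N := max L n with hN
  set g : ℕ → ℕ := fun l => φ (N + l) with hgdef
  have hg : StrictMono g := fun i j hij => hφ (by omega)
  have hg1 : N ≤ g 1 := (Nat.le_succ N).trans hφ.le_apply
  have hpow : 2 ≤ 2 ^ (m + 1) := by
    have : 2 ^ 1 ≤ 2 ^ (m + 1) := Nat.pow_le_pow_right (by norm_num) (by omega)
    simpa using this
  set q := g (2 ^ (m + 1) - 1) with hq
  have hgq : g 1 ≤ q := hg.monotone (by omega)
  refine ⟨q + 1, fun R hR c hc => ?_⟩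
  have hsign := fun c σ => norm_sum_sign_smul_le_of_prepend hn (hne 0) hCn R (by omega) c σ
  set x := ∑ i ∈ Finset.range R, c i • b i with hx
  have hcx : ∀ {i}, i ≤ q → b.coord i x = c i := fun hi => b.coord_sum_range R c (by omega)
  by_cases hsmall : ∃ l, 1 ≤ l ∧ l < 2 ^ (m + 1) ∧ |c (g l)| ≤ η / 2
  · -- a small coordinate is removed outright, and a single gap suffices
    obtain ⟨l, hl1, hl2, hl⟩ := hsmall
    have hlq : g l ≤ q := hg.monotone (by omega)
    have hl1' : g 1 ≤ g l := hg.monotone hl1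
    obtain ⟨w, hw, hwp, hwq⟩ := exists_reflection_of_removal (m := 0) hC1.le hsign
      (c := c) (y := fun i => if i = g l then c i else 0) (p := g 1) (q := q)
      (by omega) (g := fun j => g (l + j - 1)) (fun i j hij => hg (by omega))
      (by simpa using hl1') (by simpa using hlq)
      (fun k hk => by
        have : k = 0 := by simpa using hk
        subst this
        simp) (fun k hk hk0 => by simp at hk; omega)
      (fun i hi => if_neg (by omega)) (fun i hi => if_neg (by omega)) (η := η) (by
        refine le_trans ?_ hCη
        have := pow_le_pow_right₀ hC1.le (show 0 + 1 ≤ m + 1 by omega)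
        gcongr) hc (by
        simp only [ite_smul, zero_smul, Finset.sum_ite_eq', Finset.mem_range]
        rw [if_pos (by omega), norm_smul, hnorm]
        simpa using hl)
    exact ⟨w, hw, fun i hi => hwp i (by omega), fun i hi => hwq i (by omega)⟩
  · -- `v` has the coordinates of `x` at the odd points and vanishes at the even ones
    push Not at hsmall
    set s := Finset.Ico (N + 1) (N + 2 ^ (m + 1)) with hs
    have hsq : ∀ j ∈ s, φ j ≤ q := fun j hj => hφ.monotone (by
      rw [hs, Finset.mem_Ico] at hj; omega)
    have hslow : ∀ j ∈ s, η / 2 ≤ |c (φ j)| := fun j hj => by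
      rw [hs, Finset.mem_Ico] at hj
      have := hsmall (j - N) (by omega) (by omega)
      simp only [hgdef] at this
      rw [Nat.add_sub_cancel' (by omega)] at this
      exact this.le
    obtain ⟨v, hv, hvs⟩ := exists_apply_eq_of_lower_estimate (fun j => b.coord (φ j))
      (fun j => b (φ j)) (fun j => (hnorm _).le)
      (fun i j => by simp [b.ortho, Pi.single_apply, hφ.injective.eq_iff]) s
      (β := η / 2 / D) (by positivity) (fun a => by
        have hsg : ∀ j, ∃ ε : ℝ, (ε = 1 ∨ ε = -1) ∧ ε * (a j * c (φ j)) = |a j * c (φ j)| := by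
          intro j
          rcases abs_cases (a j * c (φ j)) with ⟨h, _⟩ | ⟨h, _⟩
          · exact ⟨1, Or.inl rfl, by rw [h, one_mul]⟩
          · exact ⟨-1, Or.inr rfl, by rw [h, neg_one_mul]⟩
        choose ε hε hεa using hsg
        have h1 := hD s a ε hε
        have h2 : η / 2 * ∑ j ∈ s, |a j| ≤ ‖∑ j ∈ s, (ε j * a j) • b.coord (φ j)‖ := by
          have h3 := (le_abs_self _).trans
            ((∑ j ∈ s, (ε j * a j) • b.coord (φ j)).le_opNorm x)
          refine le_trans ?_ (h3.trans (mul_le_of_le_one_right (norm_nonneg _) hc))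
          simp only [sum_apply, smul_apply, smul_eq_mul]
          rw [Finset.mul_sum]
          refine Finset.sum_le_sum fun j hj => ?_
          rw [hcx (hsq j hj), mul_assoc, hεa, abs_mul, mul_comm]
          exact mul_le_mul_of_nonneg_left (hslow j hj) (abs_nonneg _)
        rw [div_mul_eq_mul_div, div_le_iff₀ hD1]
        linarith) hA (fun j => if Odd (j - N) then c (φ j) else 0) (fun j hj => by
        split_ifs
        · rw [← hcx (hsq j hj)]
          exact (hcoord _ _).trans (mul_le_of_le_one_right hA.le hc)
        · simpa using hA.le)
    have hvg : ∀ l, 1 ≤ l → l < 2 ^ (m + 1) →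
        b.coord (g l) v = if Odd l then c (g l) else 0 := fun l h1 h2 => by
      have := hvs (N + l) (by rw [hs, Finset.mem_Ico]; omega)
      simpa using this
    have hpow' : 2 ^ (m + 1) = 2 * 2 ^ m := pow_succ' 2 m
    obtain ⟨w, hw, hwp, hwq⟩ := exists_reflection_of_removal hC1.le hsign
      (c := c) (y := fun i => if g 1 ≤ i ∧ i ≤ q then b.coord i v else 0) (p := g 1) (q := q)
      (by omega) hg le_rfl le_rfl
      (fun l hl => by
        have h1 : g 1 ≤ g (2 * l + 1) := hg.monotone (by omega)
        have h2 : g (2 * l + 1) ≤ q := hg.monotone (by omega)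
        rw [if_pos ⟨h1, h2⟩, hvg _ (by omega) (by omega), if_pos ⟨l, rfl⟩])
      (fun l hl hl0 => by
        have h1 : g 1 ≤ g (2 * l) := hg.monotone (by omega)
        have h2 : g (2 * l) ≤ q := hg.monotone (by omega)
        rw [if_pos ⟨h1, h2⟩, hvg _ (by omega) (by omega),
          if_neg (by simp)])
      (fun i hi => if_neg (by omega)) (fun i hi => if_neg (by omega)) hCη hc (by
        have heq : ∑ i ∈ Finset.range R, (if g 1 ≤ i ∧ i ≤ q then b.coord i v else 0) • b i
            = b.proj (q + 1) v - b.proj (g 1) v := by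
          rw [SchauderBasis.proj_apply, SchauderBasis.proj_apply,
            ← Finset.sum_Ico_eq_sub _ (by omega : g 1 ≤ q + 1)]
          simp only [ite_smul, zero_smul]
          rw [← Finset.sum_filter]
          refine Finset.sum_congr ?_ fun _ _ => rfl
          ext i
          simp only [Finset.mem_filter, Finset.mem_range, Finset.mem_Ico]
          omega
        rw [heq]
        exact ((hproj _ _ v).trans (mul_le_mul_of_nonneg_left hv hA.le)).trans hm)
    exact ⟨w, hw, fun i hi => hwp i (by omega), fun i hi => hwq i (by omega)⟩

/-! ### Spreading models -/

theorem norm_sum_smul_ellOneBasis (s : Finset ℕ) (a : ℕ → ℝ) :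
    ‖∑ j ∈ s, a j • ellOneBasis j‖ = ∑ j ∈ s, |a j| := by
  have := lp.norm_sum_single (p := 1) (E := fun _ : ℕ => ℝ) (by norm_num) a s
  simp only [ENNReal.toReal_one, Real.rpow_one, Real.norm_eq_abs] at this
  rw [← this]
  congr 1
  refine Finset.sum_congr rfl fun j _ => ?_
  rw [ellOneBasis, ← lp.single_smul, smul_eq_mul, mul_one]

theorem areEquivalentSeq_ellOneBasis_of_lower_estimate {E : Type*} [NormedAddCommGroup E]
    [NormedSpace ℝ E] {f : ℕ → E} (hf : ∀ j, ‖f j‖ ≤ 1) {c : ℝ} (hc : 0 < c)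
    (h : ∀ (k : ℕ) (a : ℕ → ℝ),
      c * ∑ j ∈ Finset.range k, |a j| ≤ ‖∑ j ∈ Finset.range k, a j • f j‖) :
    AreEquivalentSeq f ellOneBasis := by
  classical
  refine ⟨c, 1, hc, one_pos, fun s a => ⟨?_, ?_⟩⟩
  · obtain ⟨k, hk⟩ := s.exists_nat_subset_range
    have := h k (fun j => if j ∈ s then a j else 0)
    simp only [apply_ite abs, abs_zero, ite_smul, zero_smul, Finset.sum_ite_mem,
      Finset.inter_eq_right.2 hk] at this
    rwa [norm_sum_smul_ellOneBasis]
  · rw [norm_sum_smul_ellOneBasis, one_mul]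
    refine norm_sum_le_of_le _ fun j _ => ?_
    rw [norm_smul]
    exact mul_le_of_le_one_right (norm_nonneg _) (hf j)

/-- Averaging a nonnegative combination over `N` shifts produces the average of `f 0, …, f (N - 1)`,
up to boundary terms. -/
theorem norm_sum_range_smul_le_of_shifts {E : Type*} [NormedAddCommGroup E] [NormedSpace ℝ E]
    {f : ℕ → E} (hf : ∀ j, ‖f j‖ ≤ 1) {k : ℕ} {a : ℕ → ℝ} (ha : ∀ j, 0 ≤ a j)
    {B : ℝ} (hB : ∀ t, ‖∑ j ∈ Finset.range k, a j • f (j + t)‖ ≤ B) (N : ℕ) :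
    (∑ j ∈ Finset.range k, a j) * ‖∑ t ∈ Finset.range N, f t‖
      ≤ N * B + 2 * k * ∑ j ∈ Finset.range k, a j := by
  have hshift : ∀ j, ‖∑ t ∈ Finset.range N, f t - ∑ t ∈ Finset.range N, f (j + t)‖ ≤ 2 * j := by
    intro j
    have h1 := Finset.sum_range_add f N j
    have h2 := Finset.sum_range_add f j N
    rw [add_comm N j, h2] at h1
    have h3 : ∑ t ∈ Finset.range N, f t - ∑ t ∈ Finset.range N, f (j + t)
        = ∑ t ∈ Finset.range j, f t - ∑ t ∈ Finset.range j, f (N + t) := by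
      rw [sub_eq_sub_iff_add_eq_add]
      exact h1.symm
    rw [h3]
    have h4 : ∀ g : ℕ → E, (∀ t, ‖g t‖ ≤ 1) → ‖∑ t ∈ Finset.range j, g t‖ ≤ j := fun g hg => by
      simpa using norm_sum_le_of_le (Finset.range j) fun t _ => hg t
    have := norm_sub_le (∑ t ∈ Finset.range j, f t) (∑ t ∈ Finset.range j, f (N + t))
    have := h4 f hf
    have := h4 _ fun t => hf (N + t)
    linarith
  have hsplit : (∑ j ∈ Finset.range k, a j) • ∑ t ∈ Finset.range N, f t
      = ∑ t ∈ Finset.range N, ∑ j ∈ Finset.range k, a j • f (j + t)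
        + ∑ j ∈ Finset.range k,
          a j • (∑ t ∈ Finset.range N, f t - ∑ t ∈ Finset.range N, f (j + t)) := by
    rw [Finset.sum_comm, ← Finset.sum_add_distrib, Finset.sum_smul]
    refine Finset.sum_congr rfl fun j _ => ?_
    rw [← Finset.smul_sum, ← smul_add, add_sub_cancel]
  have hsum0 : 0 ≤ ∑ j ∈ Finset.range k, a j := Finset.sum_nonneg fun j _ => ha j
  rw [← Real.norm_of_nonneg hsum0, ← norm_smul, hsplit, Real.norm_of_nonneg hsum0]
  refine (norm_add_le _ _).trans (add_le_add ?_ ?_)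
  · simpa using norm_sum_le_of_le (Finset.range N) fun t _ => hB t
  · rw [Finset.mul_sum]
    refine norm_sum_le_of_le _ fun j hj => ?_
    rw [norm_smul, Real.norm_of_nonneg (ha j), mul_comm]
    have hjk : (j : ℝ) ≤ k := by exact_mod_cast (Finset.mem_range.1 hj).le
    exact mul_le_mul_of_nonneg_right ((hshift j).trans (by linarith)) (ha j)

/-- The definition of a spreading model with sums over `Finset.range` in place of `Fin`. -/
theorem IsSpreadingModel.exists_range {X E : Type*} [NormedAddCommGroup X] [NormedSpace ℝ X]
    [NormedAddCommGroup E] [NormedSpace ℝ E] {f : ℕ → E} {e : ℕ → X}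
    (h : IsSpreadingModel f e) : ∃ φ : ℕ → ℕ, StrictMono φ ∧
      ∀ (k : ℕ) (a : ℕ → ℝ) (δ : ℝ), 0 < δ → ∃ N : ℕ, ∀ n : ℕ → ℕ, StrictMono n → N ≤ n 0 →
        |‖∑ i ∈ Finset.range k, a i • e (φ (n i))‖ - ‖∑ i ∈ Finset.range k, a i • f i‖| < δ := by
  obtain ⟨φ, hφ, h⟩ := h
  refine ⟨φ, hφ, fun k a δ hδ => ?_⟩
  obtain ⟨N, hN⟩ := h k (fun i => a i) δ hδ
  refine ⟨N, fun n hn hn0 => ?_⟩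
  have := hN (fun i => n i) (fun i j hij => hn hij) fun i =>
    hn0.trans (hn.monotone (Nat.zero_le _))
  rwa [Fin.sum_univ_eq_sum_range (fun i => a i • e (φ (n i))) k,
    Fin.sum_univ_eq_sum_range (fun i => a i • f i) k] at this

/-- A spreading model inherits unconditionality, and the norm of its finite combinations is
invariant under shifts. So if it is not an `ℓ₁`-basis, some nonnegative combination with coefficient
sum one has small norm together with all its shifts, and the sums `f 0 + ⋯ + f (N - 1)` have norm
`o(N)`. -/
theorem exists_norm_sum_range_le_of_not_areEquivalentSeq {X E : Type*} [NormedAddCommGroup X]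
    [NormedSpace ℝ X] [NormedAddCommGroup E] [NormedSpace ℝ E] {f : ℕ → E} {e : ℕ → X}
    (he : ∀ k, ‖e k‖ = 1) (hskip : IsAsymptoticallySkippedOneUnconditional e) {φ : ℕ → ℕ}
    (hφ : StrictMono φ)
    (h : ∀ (k : ℕ) (a : ℕ → ℝ) (δ : ℝ), 0 < δ → ∃ N : ℕ, ∀ n : ℕ → ℕ, StrictMono n → N ≤ n 0 →
      |‖∑ i ∈ Finset.range k, a i • e (φ (n i))‖ - ‖∑ i ∈ Finset.range k, a i • f i‖| < δ)
    (hf : ¬ AreEquivalentSeq f ellOneBasis) {ε : ℝ} (hε : 0 < ε) :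
    ∃ N₀ : ℕ, ∀ N, N₀ ≤ N → ‖∑ t ∈ Finset.range N, f t‖ ≤ ε * N := by
  have hspread : ∀ (k : ℕ) (a : ℕ → ℝ) (t : ℕ),
      ‖∑ i ∈ Finset.range k, a i • f (i + t)‖ = ‖∑ i ∈ Finset.range k, a i • f i‖ := by
    intro k a t
    refine eq_of_forall_dist_le fun δ hδ => ?_
    obtain ⟨N, hN⟩ := h k a (δ / 2) (half_pos hδ)
    obtain ⟨N', hN'⟩ := h (t + k) (fun i => if i < t then 0 else a (i - t)) (δ / 2) (half_pos hδ)
    have h1 := hN (fun i => max N N' + (t + i)) (fun i j hij => by simp only; omega) (by omega)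
    have h2 := hN' (fun i => max N N' + i) (fun i j hij => by simp only; omega) (by omega)
    rw [Finset.sum_range_add, Finset.sum_range_add] at h2
    have hz : ∀ y : ℕ → E, ∑ i ∈ Finset.range t, (if i < t then 0 else a (i - t)) • y i = 0 :=
      fun y => Finset.sum_eq_zero fun i hi => by simp [Finset.mem_range.1 hi]
    have hz' : ∀ y : ℕ → X, ∑ i ∈ Finset.range t, (if i < t then 0 else a (i - t)) • y i = 0 :=
      fun y => Finset.sum_eq_zero fun i hi => by simp [Finset.mem_range.1 hi]
    rw [hz, hz'] at h2
    simp only [add_lt_iff_neg_left, not_lt_zero, if_false, Nat.add_sub_cancel_left, zero_add] at h2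
    simp only [add_comm _ t]
    rw [Real.dist_eq]
    rw [abs_lt] at h1 h2
    rw [abs_le]
    constructor <;> linarith [h1.1, h1.2, h2.1, h2.2]
  have hf1 : ∀ j, ‖f j‖ = 1 := by
    intro j
    have h0 : ‖f j‖ = ‖f 0‖ := by simpa using hspread 1 1 j
    rw [h0]
    refine eq_of_forall_dist_le fun δ hδ => ?_
    obtain ⟨N, hN⟩ := h 1 1 δ hδ
    have := hN (fun i => N + i) (fun i j hij => by simp only; omega) le_rfl
    rw [dist_comm, Real.dist_eq]
    simpa [he] using this.le
  have hunc : ∀ (k : ℕ) (a : ℕ → ℝ), ‖∑ i ∈ Finset.range k, |a i| • f i‖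
      ≤ 2 * ‖∑ i ∈ Finset.range k, a i • f i‖ := by
    intro k a
    refine le_of_forall_pos_le_add fun δ hδ => ?_
    obtain ⟨N, hN⟩ := h k a (δ / 4) (by positivity)
    obtain ⟨N', hN'⟩ := h k (fun i => |a i|) (δ / 4) (by positivity)
    obtain ⟨n, hn, hsk⟩ := hskip 2 (by norm_num)
    set M := N + N' + (n + 1) with hM
    have hmono : StrictMono fun i : ℕ => M + 2 * i := fun i j hij => by simp only; omega
    have h1 := hN (fun i => M + 2 * i) hmono (by omega)
    have h2 := hN' (fun i => M + 2 * i) hmono (by omega)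
    have hgap : ∀ j, φ (M + 2 * j) + 2 ≤ φ (M + 2 * (j + 1)) := fun j => by
      have h3 := hφ (show M + 2 * j < M + 2 * j + 1 by omega)
      have h4 := hφ (show M + 2 * j + 1 < M + 2 * (j + 1) by omega)
      omega
    have hsign := norm_sum_sign_smul_block_le_of_prepend
      (hsk (e 0) (Submodule.subset_span ⟨0, by simp; omega, rfl⟩) (fun h0 => by
        simpa [h0] using he 0))
      (fun j => φ (M + 2 * j)) ((by omega : n + 1 ≤ M + 2 * 0).trans hφ.le_apply) hgap
      (fun j => a j • e (φ (M + 2 * j))) (fun j => Submodule.smul_mem _ _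
        (Submodule.subset_span ⟨_, ⟨le_rfl, by have := hgap j; omega⟩, rfl⟩))
      (fun j => if 0 ≤ a j then 1 else -1) (fun j => by by_cases h : 0 ≤ a j <;> simp [h]) k
    have habs : ∀ j, (if 0 ≤ a j then (1 : ℝ) else -1) • a j • e (φ (M + 2 * j))
        = |a j| • e (φ (M + 2 * j)) := by
      intro j
      split_ifs with h
      · rw [abs_of_nonneg h, one_smul]
      · rw [abs_of_neg (by linarith), neg_one_smul, neg_smul]
    simp only [habs] at hsign
    rw [abs_lt] at h1 h2
    linarith [h1.1, h1.2, h2.1, h2.2]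
  obtain ⟨k, a, hka⟩ : ∃ (k : ℕ) (a : ℕ → ℝ), ‖∑ j ∈ Finset.range k, a j • f j‖
      < ε / 4 * ∑ j ∈ Finset.range k, |a j| := by
    by_contra hcon
    push Not at hcon
    exact hf (areEquivalentSeq_ellOneBasis_of_lower_estimate (fun j => (hf1 j).le)
      (by positivity) hcon)
  set S := ∑ j ∈ Finset.range k, |a j| with hS
  have hS0 : 0 < S := by
    have := (norm_nonneg _).trans_lt hka
    exact (mul_pos_iff_of_pos_left (by positivity)).1 this
  obtain ⟨N₀, hN₀⟩ := exists_nat_ge (4 * k / ε)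
  refine ⟨N₀, fun N hN => ?_⟩
  have hlow := norm_sum_range_smul_le_of_shifts (fun j => (hf1 j).le) (k := k)
    (a := fun j => |a j|) (fun j => abs_nonneg _) (B := ε / 2 * S) (fun t => by
      rw [hspread k (fun j => |a j|) t]
      linarith [hunc k a]) N
  have hNk : 4 * k ≤ N * ε := by
    rw [← div_le_iff₀ hε]
    exact hN₀.trans (by exact_mod_cast hN)
  have : S * ‖∑ t ∈ Finset.range N, f t‖ ≤ S * (ε * N) := by
    refine hlow.trans ?_
    have := mul_le_mul_of_nonneg_right hNk hS0.le
    rw [← hS]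
    linarith
  exact le_of_mul_le_mul_left this hS0

theorem proposition4p5 {X : Type*} [NormedAddCommGroup X] [NormedSpace ℝ X] [CompleteSpace X]
    (b : SchauderBasis ℝ X)
    (hnorm : ∀ k, ‖b k‖ = 1)
    (hskip : IsAsymptoticallySkippedOneUnconditional (fun k => b k))
    (hX : ¬ ContainsCopyOfEllOne X)
    (hau : ¬ PropertyAUStar X) :
    (∀ φ : ℕ → ℕ, StrictMono φ → ¬ IsUnconditionalSeq (fun k => b.coord (φ k))) ∧
    (∀ (E : Type*) [NormedAddCommGroup E] [NormedSpace ℝ E] [CompleteSpace E] (f : ℕ → E),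
      IsSpreadingModel f (fun k => b k) → AreEquivalentSeq f ellOneBasis) := by
  have hne : ∀ k, b k ≠ 0 := fun k h => by simpa [h] using hnorm k
  have hrefl : ¬ HasAsymptoticReflections b := fun h => hau (h.propertyAUStar fun f _ hκ =>
    exists_forall_abs_le_of_not_containsCopyOfEllOne hne hskip hX f hκ)
  refine ⟨fun φ hφ hunc => hrefl
    (hasAsymptoticReflections_of_isUnconditionalSeq_coord b hnorm hskip hφ hunc),
    fun E _ _ _ f hf => ?_⟩
  by_contra hcon
  obtain ⟨φ, hφ, hlim⟩ := hf.exists_range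
  refine hrefl (hasAsymptoticReflections_of_small_sums b hnorm hskip hφ fun ε hε => ?_)
  obtain ⟨m, hm⟩ := exists_norm_sum_range_le_of_not_areEquivalentSeq hnorm hskip hφ hlim hcon
    (half_pos hε)
  obtain ⟨N, hN⟩ := hlim (2 ^ m) 1 (ε / 2) (half_pos hε)
  refine ⟨m, fun N₀ => ⟨max N N₀, le_max_right _ _, ?_⟩⟩
  have h1 := hm (2 ^ m) Nat.lt_two_pow_self.le
  have h2 := (abs_lt.1 (hN (fun l => max N N₀ + (2 * l + 1))
    (fun i j hij => by simp only; omega) (by omega))).2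
  simp only [Pi.one_apply, one_smul] at h2
  push_cast at h1
  have h3 : (1 : ℝ) ≤ 2 ^ m := one_le_pow₀ (by norm_num)
  have h4 : ε / 2 * 1 ≤ ε / 2 * 2 ^ m := by gcongr
  linarith
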